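/- Let $R=\mathbb C[x,y,z]$ and let $I\subset R$ be an ideal of height $2$ which is minimally generated by three homogeneous polynomials of the same degree. Assume that $I$ is locally a complete intersection, i.e. for every minimal prime $\mathfrak p$ of $I$ the ideal $I_{\mathfrak p}\subset R_{\mathfrak p}$ is generated by two elements. Then $R/I$ is arithmetically Cohen–Macaulay (i.e. $R/I$ is a Cohen–Macaulay ring) if and only if there exist a minimal generating set $\{f_1,f_2,f_3\}$ of $I$ consisting of homogeneous polynomials and $A,B,C\in R$ such that $Af_1+Bf_2+Cf_3=0$ and $A,B,C$ is an $R$-regular sequence. -/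

import Mathlib

/-- The polynomial ring `ℂ[x, y, z]`. -/
abbrev PolyRing : Type := MvPolynomial (Fin 3) ℂ

/-- The depth of a local ring: the supremum of the lengths of the regular sequences
contained in the maximal ideal. -/
noncomputable def localDepth (A : Type*) [CommRing A] [IsLocalRing A] : ℕ∞ :=
  ⨆ (rs : List A) (_ : ∀ r ∈ rs, r ∈ IsLocalRing.maximalIdeal A)
    (_ : RingTheory.Sequence.IsRegular A rs), (rs.length : ℕ∞)

/-- A Cohen–Macaulay ring: a Noetherian ring all of whose localizations at maximal ideals
have depth equal to their Krull dimension. -/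
def IsCohenMacaulayRing (A : Type*) [CommRing A] : Prop :=
  IsNoetherianRing A ∧
    ∀ (m : Ideal A) [m.IsMaximal],
      (localDepth (Localization.AtPrime m) : WithBot ℕ∞) =
        ringKrullDim (Localization.AtPrime m)

/-- The quotient `R/I` is arithmetically Cohen–Macaulay: it is a Cohen–Macaulay ring. -/
def IsArithmeticallyCM (I : Ideal PolyRing) : Prop :=
  IsCohenMacaulayRing (PolyRing ⧸ I)

/-- `f 0, f 1, f 2` is a minimal (i.e. irredundant) generating set of `I` consisting of
three homogeneous polynomials. In particular the `f i` are nonzero and pairwise distinct. -/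
structure IsMinimalHomogeneousGenerators (f : Fin 3 → PolyRing) (I : Ideal PolyRing) :
    Prop where
  homogeneous : ∀ i, ∃ d : ℕ, (f i).IsHomogeneous d
  span_eq : Ideal.span (Set.range f) = I
  irredundant : ∀ i, f i ∉ Ideal.span (f '' {j | j ≠ i})

/-- `I` is minimally generated by three homogeneous polynomials of the same degree. -/
def IsMinimallyGeneratedByThreeOfSameDegree (I : Ideal PolyRing) : Prop :=
  ∃ (d : ℕ) (f : Fin 3 → PolyRing),
    IsMinimalHomogeneousGenerators f I ∧ ∀ i, (f i).IsHomogeneous d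

/-- `I` (of height two) is locally a complete intersection: for every minimal prime `p` of `I`
the ideal `I_p` of `R_p` is generated by two elements. -/
def IsLocallyCompleteIntersection (I : Ideal PolyRing) : Prop :=
  ∀ (p : Ideal PolyRing) [p.IsPrime], p ∈ I.minimalPrimes →
    ∃ a b : Localization.AtPrime p,
      I.map (algebraMap PolyRing (Localization.AtPrime p)) = Ideal.span {a, b}

/-- `(A, B, C)` is a first syzygy on `I`: it is a relation on some minimal generating set of
homogeneous polynomials of `I`. -/
def IsFirstSyzygy (I : Ideal PolyRing) (A B C : PolyRing) : Prop :=
  ∃ f : Fin 3 → PolyRing, IsMinimalHomogeneousGenerators f I ∧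
    A * f 0 + B * f 1 + C * f 2 = 0

/-- A regular syzygy on `I`: a first syzygy whose entries form an `R`-regular sequence. -/
def IsRegularSyzygy (I : Ideal PolyRing) (A B C : PolyRing) : Prop :=
  IsFirstSyzygy I A B C ∧ RingTheory.Sequence.IsRegular PolyRing [A, B, C]

/-! The proof compares both sides with the syzygies of the generators `f`. As `I` has height two,
`R/I` has dimension at most one. It is therefore Cohen–Macaulay as soon as no maximal ideal kills a
nonzero class, i.e. as soon as there is no socle (`isArithmeticallyCM_of_forall`). Conversely, the
Cohen–Macaulay property excludes a socle at the origin (`IsArithmeticallyCM.mem_of_forall_mul_mem`).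

Given a regular syzygy `A`, exactness of the Koszul complex writes `f` as a cross product of `A`
with another vector, so the `f i` are the minors of a `3 × 2` matrix. They have no common factor,
hence the two columns form a basis of the syzygies (`exact_linearCombination_cross`). A chase
between the Koszul complex and the resolution `0 → R² → R³ → R` then excludes a socle at every
closed point (`mem_range_of_exact`).

Given the Cohen–Macaulay property, the same chase run backwards makes a minimal homogeneous system
of syzygies free (`injective_of_exact`), and a rank count gives a basis `v`, `w` of degrees `m ≤ n`.
Its minors are `f` up to a unit (`exists_isUnit_cross_eq_smul`). The locally complete intersection
condition says that `v` and `w` do not both vanish at a minimal prime of `I`, so a general form `h`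
of degree `n - m` makes `A = w + h v` vanish at none of them. The minors of `v`, `A` still generate
`I`; a prime containing the entries of `A` thus lies strictly above a minimal prime of `I` and has
height at least three. Forms cutting out codimension three are a regular sequence
(`isRegularTriple_of_three_le_height`). -/

/-- The three conditions saying that `x, y, z` is a weakly regular sequence. -/
structure IsRegularTriple {R : Type*} [CommRing R] (x y z : R) : Prop where
  first : ∀ a, x * a = 0 → a = 0
  second : ∀ a b, y * a = x * b → ∃ c, a = x * c
  third : ∀ a b c, z * a = x * b + y * c → ∃ d e, a = x * d + y * e

namespace IsRegularTriple

/-! ### Koszul exactness and two diagram chases -/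

section Koszul

variable {R : Type*} [CommRing R] {x y z : R}

/-- Exactness of the Koszul complex in the middle: relations are cross products. -/
theorem exists_cross (h : IsRegularTriple x y z) {a b c : R} (e : x * a + y * b + z * c = 0) :
    ∃ u v w, a = y * w - z * v ∧ b = z * u - x * w ∧ c = x * v - y * u := by
  obtain ⟨d, e', rfl⟩ := h.third c (-a) (-b) (by linear_combination e)
  obtain ⟨c', hc⟩ := h.second (b + z * e') (-(a + z * d)) (by linear_combination e)
  have ha := h.first (a + z * d + y * c') (by linear_combination e - y * hc)
  exact ⟨-e', d, -c', by linear_combination ha, by linear_combination hc, by ring⟩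

/-- Exactness of the Koszul complex at the second spot. -/
theorem exists_eq_mul (h : IsRegularTriple x y z) {p q r : R} (h₁ : y * p = x * q)
    (h₂ : z * p = x * r) : ∃ t, p = x * t ∧ q = y * t ∧ r = z * t := by
  obtain ⟨t, rfl⟩ := h.second p q h₁
  refine ⟨t, rfl, ?_, ?_⟩
  · linear_combination h.first (q - y * t) (by linear_combination -h₁)
  · linear_combination h.first (r - z * t) (by linear_combination -h₂)

variable {ι κ : Type*}

theorem exists_cross_pi (h : IsRegularTriple x y z) {a b c : ι → R}
    (e : x • a + y • b + z • c = 0) :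
    ∃ u v w : ι → R, a = y • w - z • v ∧ b = z • u - x • w ∧ c = x • v - y • u := by
  have := fun i ↦ h.exists_cross (congrFun e i)
  choose u v w h₁ h₂ h₃ using this
  exact ⟨u, v, w, funext h₁, funext h₂, funext h₃⟩

theorem exists_eq_smul_pi (h : IsRegularTriple x y z) {p q r : ι → R} (h₁ : y • p = x • q)
    (h₂ : z • p = x • r) : ∃ t : ι → R, p = x • t ∧ q = y • t ∧ r = z • t := by
  have := fun i ↦ h.exists_eq_mul (congrFun h₁ i) (congrFun h₂ i)
  choose t h₁ h₂ h₃ using this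
  exact ⟨t, funext h₁, funext h₂, funext h₃⟩

variable {L : (κ → R) →ₗ[R] (ι → R)} {F : (ι → R) →ₗ[R] R}

/-- If `0 → R^κ → R^ι → R` is exact, then the cokernel has no element killed by a regular
sequence of length three. -/
theorem mem_range_of_exact (h : IsRegularTriple x y z) (hLF : Function.Exact L F)
    (hL : Function.Injective L) {s : R} (hx : x * s ∈ LinearMap.range F)
    (hy : y * s ∈ LinearMap.range F) (hz : z * s ∈ LinearMap.range F) :
    s ∈ LinearMap.range F := by
  obtain ⟨p, hp⟩ := hx
  obtain ⟨q, hq⟩ := hy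
  obtain ⟨r, hr⟩ := hz
  -- The lifts of `x s`, `y s`, `z s` differ by syzygies, which come from `a`, `b`, `c`; injectivity
  -- of `L` turns these into a Koszul relation.
  obtain ⟨c, hc⟩ := (hLF (x • q - y • p)).1 (by simp [hp, hq]; ring)
  obtain ⟨b, hb⟩ := (hLF (z • p - x • r)).1 (by simp [hp, hr]; ring)
  obtain ⟨a, ha⟩ := (hLF (y • r - z • q)).1 (by simp [hq, hr]; ring)
  have habc : x • a + y • b + z • c = 0 := by
    apply hL
    simp only [map_add, map_smul, ha, hb, hc, map_zero]
    module
  obtain ⟨u, v, w, rfl, rfl, rfl⟩ := h.exists_cross_pi habc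
  simp only [map_sub, map_smul] at ha hb hc
  -- Corrected by syzygies, the three lifts become proportional to `x`, `y`, `z`; the common factor
  -- `t` is a lift of `s`.
  obtain ⟨t, ht, -, -⟩ := h.exists_eq_smul_pi (p := p - L u) (q := q - L v) (r := r - L w)
    (by linear_combination (norm := module) hc) (by linear_combination (norm := module) -hb)
  refine ⟨t, ?_⟩
  have hFL : F (L u) = 0 := (hLF _).2 ⟨u, rfl⟩
  have := congrArg F ht
  rw [map_sub, hFL, hp, sub_zero, map_smul, smul_eq_mul] at this
  linear_combination -h.first (s - F t) (by linear_combination this)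

/-- A generating family of the syzygies whose relations have no unit coefficients is free if the
cokernel has no socle. -/
theorem injective_of_exact [IsDomain R] [IsNoetherianRing R] (h : IsRegularTriple x y z)
    (hne : Ideal.span {x, y, z} ≠ ⊤)
    (hLF : Function.Exact L F) (hmin : ∀ a, L a = 0 → ∀ k, a k ∈ Ideal.span {x, y, z})
    (hsocle : ∀ s, x * s ∈ LinearMap.range F → y * s ∈ LinearMap.range F →
      z * s ∈ LinearMap.range F → s ∈ LinearMap.range F) :
    Function.Injective L := by
  have step : ∀ a, L a = 0 → ∃ b c d, L b = 0 ∧ L c = 0 ∧ L d = 0 ∧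
      a = x • b + y • c + z • d := by
    intro a ha
    have : ∀ k, ∃ b c d, a k = x * b + y * c + z * d := fun k ↦ by
      obtain ⟨b, c, d, hk⟩ := Submodule.mem_span_triple.1 (hmin a ha k)
      exact ⟨b, c, d, by rw [← hk]; simp [mul_comm]⟩
    choose b c d hbcd using this
    have hbcd : a = x • b + y • c + z • d := funext hbcd
    obtain ⟨U, V, W, h₁, h₂, h₃⟩ := h.exists_cross_pi (a := L b) (b := L c) (c := L d)
      (by rw [← ha, hbcd]; simp)
    have hF : ∀ k, F (L k) = 0 := fun k ↦ (hLF _).2 ⟨k, rfl⟩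
    have e₁ := hF b
    have e₂ := hF c
    have e₃ := hF d
    simp only [h₁, h₂, h₃, map_sub, map_smul, smul_eq_mul] at e₁ e₂ e₃
    -- The images of `U`, `V`, `W` are `x t`, `y t`, `z t`, so `t` represents a socle element and
    -- lifts to `τ`. The remaining errors are syzygies, and `μ₁`, `μ₂`, `μ₃` correct `b`, `c`, `d`
    -- into relations.
    obtain ⟨t, hU, hV, hW⟩ := h.exists_eq_mul (p := F U) (q := F V) (r := F W)
      (by linear_combination -e₃) (by linear_combination e₂)
    obtain ⟨τ, rfl⟩ := hsocle t ⟨U, hU⟩ ⟨V, hV⟩ ⟨W, hW⟩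
    obtain ⟨μ₁, hμ₁⟩ := (hLF (U - x • τ)).1 (by simp [hU])
    obtain ⟨μ₂, hμ₂⟩ := (hLF (V - y • τ)).1 (by simp [hV])
    obtain ⟨μ₃, hμ₃⟩ := (hLF (W - z • τ)).1 (by simp [hW])
    refine ⟨b - y • μ₃ + z • μ₂, c - z • μ₁ + x • μ₃, d - x • μ₂ + y • μ₁, ?_, ?_, ?_, ?_⟩
    · simp only [map_sub, map_add, map_smul, h₁, hμ₂, hμ₃]; module
    · simp only [map_sub, map_add, map_smul, h₂, hμ₁, hμ₃]; module
    · simp only [map_sub, map_add, map_smul, h₃, hμ₂, hμ₁]; module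
    · rw [hbcd]; module
  -- Iterating `step` puts the coefficients of a relation in every power of the ideal; Krull's
  -- intersection theorem then kills them.
  have key : ∀ n a, L a = 0 → ∀ k, a k ∈ Ideal.span {x, y, z} ^ n := by
    intro n
    induction n with
    | zero => simp
    | succ n ih =>
      intro a ha k
      obtain ⟨b, c, d, hb, hc, hd, rfl⟩ := step a ha
      rw [pow_succ']
      refine add_mem (add_mem ?_ ?_) ?_
      · exact Ideal.mul_mem_mul (Ideal.subset_span (by simp)) (ih b hb k)
      · exact Ideal.mul_mem_mul (Ideal.subset_span (by simp)) (ih c hc k)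
      · exact Ideal.mul_mem_mul (Ideal.subset_span (by simp)) (ih d hd k)
  rw [injective_iff_map_eq_zero]
  intro a ha
  funext k
  have : a k ∈ (⨅ n, Ideal.span {x, y, z} ^ n : Ideal R) :=
    (Submodule.mem_iInf _).2 fun n ↦ key n a ha k
  rwa [Ideal.iInf_pow_eq_bot_of_isDomain _ hne] at this

end Koszul

end IsRegularTriple

/-! ### Regular sequences of length three -/

open MvPolynomial

theorem isWeaklyRegular_triple_iff {R : Type*} [CommRing R] {x y z : R} :
    RingTheory.Sequence.IsWeaklyRegular R [x, y, z] ↔ IsRegularTriple x y z := by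
  rw [RingTheory.Sequence.isWeaklyRegular_iff_Fin]
  simp only [isSMulRegular_quotient_iff_mem_of_smul_mem, smul_eq_mul, Ideal.mul_top]
  have h2 : Ideal.ofList [x, y] = Ideal.span {x, y} := by
    simp [Ideal.ofList_cons, Ideal.span_insert]
  constructor
  · intro h
    refine ⟨fun a ha ↦ ?_, fun a b hab ↦ ?_, fun a b c habc ↦ ?_⟩
    · simpa [ha] using h ⟨0, by simp⟩ a
    · have := h ⟨1, by simp⟩ a
      simp only [List.take_succ_cons, List.take_zero, Ideal.ofList_singleton, Fin.getElem_fin,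
        List.getElem_cons_succ, List.getElem_cons_zero, Ideal.mem_span_singleton] at this
      exact this ⟨b, hab⟩
    · have := h ⟨2, by simp⟩ a
      simp only [List.take_succ_cons, List.take_zero, Fin.getElem_fin, h2,
        List.getElem_cons_succ, List.getElem_cons_zero, Ideal.mem_span_pair] at this
      obtain ⟨d, e, rfl⟩ := this ⟨b, c, by rw [habc]; ring⟩
      exact ⟨d, e, by ring⟩
  · rintro ⟨h1, h3, h4⟩ ⟨i, hi⟩ a
    have hi' : i < 3 := hi
    interval_cases i
    · simpa using h1 a
    · simp only [List.take_succ_cons, List.take_zero, Ideal.ofList_singleton, Fin.getElem_fin,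
        List.getElem_cons_succ, List.getElem_cons_zero, Ideal.mem_span_singleton]
      rintro ⟨b, hb⟩
      exact h3 a b hb
    · simp only [List.take_succ_cons, List.take_zero, Fin.getElem_fin, h2,
        List.getElem_cons_succ, List.getElem_cons_zero, Ideal.mem_span_pair]
      rintro ⟨b, c, hbc⟩
      obtain ⟨d, e, rfl⟩ := h4 a b c (by rw [← hbc]; ring)
      exact ⟨d, e, by ring⟩

theorem isRegular_triple_iff {R : Type*} [CommRing R] {x y z : R} :
    RingTheory.Sequence.IsRegular R [x, y, z] ↔
      IsRegularTriple x y z ∧ Ideal.span {x, y, z} ≠ ⊤ := by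
  rw [RingTheory.Sequence.isRegular_iff, isWeaklyRegular_triple_iff]
  have : Ideal.ofList [x, y, z] = Ideal.span {x, y, z} := by
    simp [Ideal.ofList_cons, Ideal.span_insert]
  simp [this, eq_comm]

/-- Serves to carry the regular sequence of coordinates to an arbitrary closed point. -/
theorem IsRegularTriple.map {R S : Type*} [CommRing R] [CommRing S] (e : R ≃+* S) {x y z : R}
    (h : IsRegularTriple x y z) : IsRegularTriple (e x) (e y) (e z) := by
  refine ⟨fun a ha ↦ ?_, fun a b hab ↦ ?_, fun a b c habc ↦ ?_⟩
  · simpa using h.first (e.symm a) (e.injective (by simp [ha]))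
  · obtain ⟨c, hc⟩ := h.second (e.symm a) (e.symm b) (e.injective (by simp [hab]))
    exact ⟨e c, by rw [← map_mul, ← hc]; simp⟩
  · obtain ⟨c, d, hc⟩ := h.third (e.symm a) (e.symm b) (e.symm c) (e.injective (by simp [habc]))
    exact ⟨e c, e d, by rw [← map_mul, ← map_mul, ← map_add, ← hc]; simp⟩

theorem isRegularTriple_X {K : Type*} [Field K] :
    IsRegularTriple (X 0 : MvPolynomial (Fin 3) K) (X 1) (X 2) := by
  refine ⟨fun a ha ↦ ?_, fun a b hab ↦ ?_, fun a b c habc ↦ ?_⟩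
  · simpa using ha
  · have : (X 0 : MvPolynomial (Fin 3) K) ∣ X 1 * a := ⟨b, hab⟩
    refine ((X_prime (i := 0)).dvd_or_dvd this).resolve_left ?_
    rw [X_dvd_X]
    decide
  · have hmem : ∀ p : MvPolynomial (Fin 3) K, p ∈ Ideal.span {X 0, X 1} ↔
        ∀ m ∈ p.support, ∃ i ∈ ({0, 1} : Set (Fin 3)), m i ≠ 0 := fun p ↦ by
      rw [← mem_ideal_span_X_image, Set.image_pair]
    have h2 : a * X 2 ∈ Ideal.span {(X 0 : MvPolynomial (Fin 3) K), X 1} :=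
      Ideal.mem_span_pair.2 ⟨b, c, by linear_combination -habc⟩
    have h3 : a ∈ Ideal.span {(X 0 : MvPolynomial (Fin 3) K), X 1} := by
      rw [hmem] at h2 ⊢
      intro m hm
      obtain ⟨i, hi, hmi⟩ := h2 (m + Finsupp.single 2 1) (by
        rw [mem_support_iff, coeff_mul_X]; exact mem_support_iff.1 hm)
      refine ⟨i, hi, ?_⟩
      rcases hi with rfl | rfl <;> simpa using hmi
    obtain ⟨d, e, h⟩ := Ideal.mem_span_pair.1 h3
    exact ⟨d, e, by rw [← h]; ring⟩

/-! ### Closed points and heights in the polynomial ring -/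

theorem MvPolynomial.mem_idealOfVars_iff {σ K : Type*} [CommRing K] {p : MvPolynomial σ K} :
    p ∈ idealOfVars σ K ↔ coeff 0 p = 0 := by
  rw [idealOfVars, ← Set.image_univ, mem_ideal_span_X_image]
  constructor
  · intro h
    by_contra h0
    obtain ⟨i, -, hi⟩ := h 0 (mem_support_iff.2 h0)
    simp at hi
  · intro h m hm
    by_contra! hc
    have : m = 0 := Finsupp.ext fun i ↦ hc i trivial
    exact mem_support_iff.1 hm (this ▸ h)

theorem MvPolynomial.coeff_zero_eq_eval {σ K : Type*} [CommRing K] (p : MvPolynomial σ K) :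
    coeff 0 p = eval 0 p := by
  rw [eval_zero]; rfl

/-- Every maximal ideal is a translate of the ideal of the origin. -/
theorem exists_ringEquiv_comap_eq_idealOfVars {σ K : Type*} [Field K] [IsAlgClosed K] [Finite σ]
    (m : Ideal (MvPolynomial σ K)) [hm : m.IsMaximal] :
    ∃ e : MvPolynomial σ K ≃+* MvPolynomial σ K, m.comap e = idealOfVars σ K := by
  obtain ⟨c, rfl⟩ := isMaximal_iff_eq_vanishingIdeal_singleton.1 hm
  let e : MvPolynomial σ K ≃ₐ[K] MvPolynomial σ K :=
    AlgEquiv.ofAlgHom (aeval fun i ↦ X i - C (c i)) (aeval fun i ↦ X i + C (c i))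
      (by ext i; simp) (by ext i; simp)
  refine ⟨e.toRingEquiv, ?_⟩
  ext p
  have : (aeval c).comp e.toAlgHom = aeval (0 : σ → K) := by
    ext i; simp [e]
  have := DFunLike.congr_fun this p
  simp only [Ideal.mem_comap, mem_idealOfVars_iff, mem_vanishingIdeal_singleton_iff,
    coeff_zero_eq_eval]
  simp only [AlgHom.comp_apply] at this
  rw [← coe_aeval_eq_eval]
  exact this ▸ Iff.rfl

theorem ringKrullDim_polyRing : ringKrullDim PolyRing = 3 := by
  rw [MvPolynomial.ringKrullDim_of_isNoetherianRing, ringKrullDim_eq_zero_of_field]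
  simp

instance : FiniteRingKrullDim PolyRing :=
  finiteRingKrullDim_iff_ne_bot_and_top.2
    (by rw [ringKrullDim_polyRing]; exact ⟨by decide, by decide⟩)

/-- Some maximal ideal attains the dimension, and automorphisms carry all maximal ideals to the
origin. -/
theorem height_idealOfVars : (idealOfVars (Fin 3) ℂ).height = 3 := by
  obtain ⟨m, hm, h⟩ := Ideal.exists_isMaximal_height (R := PolyRing)
  obtain ⟨e, he⟩ := exists_ringEquiv_comap_eq_idealOfVars m
  rw [← he, e.height_comap]
  rw [ringKrullDim_polyRing] at h
  exact WithBot.coe_inj.1 h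

theorem height_le_three (P : Ideal PolyRing) [P.IsPrime] : P.height ≤ 3 := by
  have := Ideal.height_le_ringKrullDim_of_isPrime (I := P)
  rw [ringKrullDim_polyRing] at this
  exact WithBot.coe_le_coe.1 this

theorem isMaximal_of_three_le_height (P : Ideal PolyRing) [P.IsPrime] (h : 3 ≤ P.height) :
    P.IsMaximal := by
  refine Ideal.isMaximal_of_height_eq_ringKrullDim ?_
  rw [ringKrullDim_polyRing, le_antisymm (height_le_three P) h]
  rfl

theorem idealOfVars_isMaximal (σ K : Type*) [Field K] : (idealOfVars σ K).IsMaximal := by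
  have : idealOfVars σ K = RingHom.ker (constantCoeff (σ := σ) (R := K)) := by
    ext p
    rw [mem_idealOfVars_iff, RingHom.mem_ker]; rfl
  rw [this]
  exact RingHom.ker_isMaximal_of_surjective _ fun c ↦ ⟨C c, by simp⟩

theorem exists_isPrime_mem_mem_height_le_two {R : Type*} [CommRing R] [IsNoetherianRing R] {x y : R}
    (h : Ideal.span {x, y} ≠ ⊤) : ∃ Q : Ideal R, Q.IsPrime ∧ x ∈ Q ∧ y ∈ Q ∧ Q.height ≤ 2 := by
  obtain ⟨Q, hQ⟩ := Ideal.nonempty_minimalPrimes h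
  refine ⟨Q, hQ.1.1, hQ.1.2 (Ideal.subset_span (by simp)), hQ.1.2 (Ideal.subset_span (by simp)), ?_⟩
  refine (Ideal.height_le_card_of_mem_minimalPrimes_span (Set.toFinite _) hQ).trans ?_
  have := Set.ncard_insert_le x {y}
  rw [Set.ncard_singleton] at this
  exact_mod_cast this

-- Homogeneous primes and vectors without common factor

attribute [local instance] MvPolynomial.gradedAlgebra

/-- A prime ideal contains a homogeneous prime ideal with the same homogeneous elements. -/
theorem exists_homogeneous_isPrime_le {σ K : Type*} [Field K] (P : Ideal (MvPolynomial σ K))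
    [hP : P.IsPrime] : ∃ Q : Ideal (MvPolynomial σ K), Q.IsPrime ∧ Q ≤ P ∧ Q ≤ idealOfVars σ K ∧
      ∀ p n, p.IsHomogeneous n → p ∈ P → p ∈ Q := by
  refine ⟨(P.homogeneousCore (homogeneousSubmodule σ K)).toIdeal, hP.homogeneousCore,
    Ideal.toIdeal_homogeneousCore_le _ _, ?_, fun p n hp hpP ↦ ?_⟩
  · intro p hp
    have h0 := (P.homogeneousCore (homogeneousSubmodule σ K)).isHomogeneous 0 hp
    rw [mem_idealOfVars_iff]
    by_contra h
    have hmem := Ideal.toIdeal_homogeneousCore_le _ _ h0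
    refine hP.ne_top (Ideal.eq_top_of_isUnit_mem _ hmem ?_)
    have : ((DirectSum.decompose (homogeneousSubmodule σ K) p 0 : _) : MvPolynomial σ K)
        = C (coeff 0 p) := by
      rw [← homogeneousComponent_zero]
      exact decomposition.decompose'_apply p 0
    rw [this]
    exact (isUnit_iff_ne_zero.2 h).map C
  · exact Ideal.mem_homogeneousCore_of_homogeneous_of_mem ⟨n, hp⟩ hpP

/-- The homogeneous core of `P` is a prime still containing the generators, so minimality makes `P`
equal to it, and a homogeneous proper ideal lies in the ideal of the origin. -/
theorem minimalPrimes_span_le_idealOfVars {σ K ι : Type*} [Field K] {f : ι → MvPolynomial σ K}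
    (hf : ∀ i, ∃ n, (f i).IsHomogeneous n) {P : Ideal (MvPolynomial σ K)}
    (hP : P ∈ (Ideal.span (Set.range f)).minimalPrimes) : P ≤ idealOfVars σ K := by
  have := hP.1.1
  obtain ⟨Q, hQ, hQP, hQm, hmem⟩ := exists_homogeneous_isPrime_le P
  refine le_trans (hP.2 ⟨hQ, ?_⟩ hQP) hQm
  rw [Ideal.span_le]
  rintro _ ⟨i, rfl⟩
  obtain ⟨n, hn⟩ := hf i
  exact hmem _ n hn (hP.1.2 (Ideal.subset_span ⟨i, rfl⟩))

/-- A vector parallel to a vector whose entries have no common factor is a multiple of it. -/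
theorem exists_eq_smul_of_mul_eq_mul {R ι : Type*} [CommRing R] [IsDomain R]
    [UniqueFactorizationMonoid R] {f c : ι → R} (hf : ∀ π, Prime π → ∃ i, ¬ π ∣ f i)
    (hf0 : f ≠ 0) (h : ∀ i j, f i * c j = f j * c i) : ∃ g : R, c = g • f := by
  obtain ⟨i, hi⟩ := Function.ne_iff.1 hf0
  obtain ⟨d, n, g, hrel, hd, hn⟩ :=
    UniqueFactorizationMonoid.exists_reduced_factors (f i) hi (c i)
  have hg : g ≠ 0 := by rintro rfl; simp [← hd] at hi
  have hd' : ∀ j, d * c j = n * f j := fun j ↦ by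
    have := h i j
    rw [← hd, ← hn] at this
    exact mul_left_cancel₀ hg (by linear_combination this)
  -- The reduced denominator of `c i / f i` divides every `f j`, hence is a unit.
  have hdvd : ∀ j, d ∣ f j := fun j ↦ hrel.dvd_of_dvd_mul_left ⟨c j, (hd' j).symm⟩
  have hdu : IsUnit d := by
    by_contra hdu
    have hd0 : d ≠ 0 := by rintro rfl; simp [← hd] at hi
    obtain ⟨π, hπ, hπd⟩ := WfDvdMonoid.exists_irreducible_factor hdu hd0
    obtain ⟨j, hj⟩ := hf π hπ.prime
    exact hj (hπd.trans (hdvd j))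
  obtain ⟨u, rfl⟩ := hdu
  refine ⟨↑u⁻¹ * n, funext fun j ↦ ?_⟩
  have := hd' j
  simp only [Pi.smul_apply, smul_eq_mul, mul_assoc, ← this]
  simp

/-- The generators of an ideal of height two have no common prime factor. -/
theorem exists_not_dvd_of_two_le_height {R ι : Type*} [CommRing R] [IsNoetherianRing R]
    {f : ι → R} (h : 2 ≤ (Ideal.span (Set.range f)).height) (π : R) (hπ : Prime π) :
    ∃ i, ¬ π ∣ f i := by
  by_contra! hc
  have h1 : Ideal.span (Set.range f) ≤ Ideal.span {π} := by
    rw [Ideal.span_le]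
    rintro _ ⟨i, rfl⟩
    exact Ideal.mem_span_singleton.2 (hc i)
  have := (h.trans (Ideal.height_mono h1)).trans (Ideal.height_span_singleton_le_one hπ.not_isUnit)
  exact absurd this (by decide)

/-! ### Depth and the Cohen–Macaulay property in dimension at most one -/

section LocalRing

theorem localDepth_le_ringKrullDim (A : Type*) [CommRing A] [IsLocalRing A] [IsNoetherianRing A] :
    (localDepth A : WithBot ℕ∞) ≤ ringKrullDim A := by
  have hne : ringKrullDim A ≠ ⊥ := ringKrullDim_ne_bot
  obtain ⟨d, hd⟩ := WithBot.ne_bot_iff_exists.1 hne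
  rw [← hd, WithBot.coe_le_coe, localDepth]
  refine iSup_le fun rs ↦ iSup_le fun _ ↦ iSup_le fun hreg ↦ ?_
  have h := ringKrullDim_add_length_eq_ringKrullDim_of_isRegular rs hreg
  have : Nontrivial (A ⧸ Ideal.ofList rs) := by
    rw [Ideal.Quotient.nontrivial_iff]
    intro h
    exact hreg.top_ne_smul (by simp [h])
  obtain ⟨e, he⟩ := WithBot.ne_bot_iff_exists.1
    (ringKrullDim_nonneg_of_nontrivial (R := A ⧸ Ideal.ofList rs) |>.trans_lt' (by simp)).ne'
  rw [← hd, ← he] at h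
  have h' : e + (rs.length : ℕ∞) = d := WithBot.coe_inj.1 h
  rw [← h']
  exact le_add_self

theorem one_le_localDepth_iff {A : Type*} [CommRing A] [IsLocalRing A] :
    1 ≤ localDepth A ↔ ∃ r ∈ IsLocalRing.maximalIdeal A, IsSMulRegular A r := by
  constructor
  · intro h
    by_contra! hc
    have : localDepth A ≤ 0 := by
      refine iSup_le fun rs ↦ iSup_le fun hmem ↦ iSup_le fun hreg ↦ ?_
      cases rs with
      | nil => simp
      | cons r rs =>
        exact absurd ((RingTheory.Sequence.isRegular_cons_iff A r rs).1 hreg).1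
          (hc r (hmem r (by simp)))
    exact absurd (h.trans this) (by decide)
  · rintro ⟨r, hr, hreg⟩
    have : RingTheory.Sequence.IsRegular A [r] := by
      refine ⟨(RingTheory.Sequence.isWeaklyRegular_singleton_iff A r).2 hreg, fun h ↦ ?_⟩
      simp only [Ideal.ofList_singleton, smul_eq_mul, Ideal.mul_top] at h
      exact hr (Ideal.span_singleton_eq_top.1 h.symm)
    refine le_trans ?_ (le_iSup_of_le [r] (le_iSup_of_le (by simpa using hr)
      (le_iSup_of_le this le_rfl)))
    simp

end LocalRing

/-- A Noetherian ring of dimension at most one without socle at its maximal ideals is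
Cohen–Macaulay. -/
theorem isCohenMacaulayRing_of_ringKrullDim_le_one {A : Type*} [CommRing A] [IsNoetherianRing A]
    (hdim : ringKrullDim A ≤ 1)
    (hsoc : ∀ (m : Ideal A) [m.IsMaximal], ∀ s, (∀ r ∈ m, r * s = 0) → s = 0) :
    IsCohenMacaulayRing A := by
  refine ⟨inferInstance, fun m hm ↦ le_antisymm (localDepth_le_ringKrullDim _) ?_⟩
  have h1 : ringKrullDim (Localization.AtPrime m) ≤ 1 := by
    rw [IsLocalization.AtPrime.ringKrullDim_eq_height m]
    exact Ideal.height_le_ringKrullDim_of_isPrime.trans hdim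
  refine h1.trans ?_
  suffices 1 ≤ localDepth (Localization.AtPrime m) from WithBot.coe_le_coe.2 this
  rw [one_le_localDepth_iff]
  have hr : ∃ r ∈ m, IsSMulRegular A r := by
    by_contra! hc
    have hsub : (m : Set A) ⊆ ⋃ p ∈ associatedPrimes A A, (id p : Ideal A) := by
      intro r hr
      have := biUnion_associatedPrimes_eq_compl_regular A A
      simp only [id]
      rw [this]
      exact hc r hr
    -- Prime avoidance: if `m` consists of zero divisors it lies in one associated prime, the
    -- annihilator of some `x`, which is then a socle element.
    obtain ⟨p, hp, hmp⟩ := (Ideal.subset_union_prime_finite (associatedPrimes.finite A A) 0 0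
      fun p hp _ _ ↦ hp.1).1 hsub
    obtain ⟨hpp, x, hx⟩ := isAssociatedPrime_iff.1 hp
    have hx0 := hsoc m x fun r hr ↦ by
      have : r ∈ Submodule.colon (⊥ : Submodule A A) {x} := hx ▸ hmp hr
      simpa [Submodule.mem_colon_singleton] using this
    apply hpp.ne_top
    rw [hx, hx0]
    ext r
    simp [Submodule.mem_colon_singleton]
  obtain ⟨r, hrm, hr⟩ := hr
  refine ⟨algebraMap A _ r, ?_, hr.of_isLocalization _ m.primeCompl⟩
  rw [← Localization.AtPrime.map_eq_maximalIdeal]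
  exact Ideal.mem_map_of_mem _ hrm

/-- Positive height forces positive local depth, and a regular element of the local maximal ideal
kills the image of `s`; so `s` vanishes locally. -/
theorem IsCohenMacaulayRing.exists_mul_eq_zero {A : Type*} [CommRing A]
    (hA : IsCohenMacaulayRing A) (m : Ideal A) [m.IsMaximal] (hm : 1 ≤ m.height) {s : A}
    (hs : ∀ r ∈ m, r * s = 0) : ∃ t ∉ m, t * s = 0 := by
  have := hA.1
  have h1 := hA.2 m
  rw [IsLocalization.AtPrime.ringKrullDim_eq_height m, WithBot.coe_inj] at h1
  rw [← h1, one_le_localDepth_iff] at hm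
  obtain ⟨r, hr, hreg⟩ := hm
  have hall : ∀ r ∈ IsLocalRing.maximalIdeal (Localization.AtPrime m),
      r * algebraMap A _ s = 0 := by
    intro r hr
    rw [← Localization.AtPrime.map_eq_maximalIdeal] at hr
    refine Submodule.span_induction (p := fun r _ ↦ r * algebraMap A _ s = 0) ?_ (by simp) ?_ ?_ hr
    · rintro _ ⟨a, ha, rfl⟩
      rw [← map_mul, hs a ha, map_zero]
    · intro a b _ _ ha hb
      rw [add_mul, ha, hb, add_zero]
    · intro a b _ hb
      rw [smul_eq_mul, mul_assoc, hb, mul_zero]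
  have h0 : algebraMap A (Localization.AtPrime m) s = 0 := hreg (by simpa using hall r hr)
  obtain ⟨t, ht⟩ := (IsLocalization.map_eq_zero_iff m.primeCompl _ s).1 h0
  exact ⟨t, t.2, ht⟩

/-! ### Cohen–Macaulayness of the quotient and its socle -/

theorem ringKrullDim_quotient_le_one {I : Ideal PolyRing} (hI : 2 ≤ I.height) :
    ringKrullDim (PolyRing ⧸ I) ≤ 1 := by
  rw [ringKrullDim_le_iff_height_le]
  intro p hp
  suffices p.height ≤ 1 from WithBot.coe_le_coe.2 this
  have hsurj := Ideal.Quotient.mk_surjective (I := I)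
  have hlt : ∀ {a b : Ideal (PolyRing ⧸ I)} [a.IsPrime] [b.IsPrime], a < b →
      (a.comap (Ideal.Quotient.mk I)).height + 1 ≤ (b.comap (Ideal.Quotient.mk I)).height :=
    fun {a b} _ _ hab ↦ Ideal.height_add_one_le_of_lt_of_isPrime
      (lt_of_le_of_ne (Ideal.comap_mono hab.le)
        fun h ↦ hab.ne (Ideal.comap_injective_of_surjective _ hsurj h))
  refine Ideal.height_le_iff (n := 1).2 fun q hq hqp ↦ ?_
  suffices q.height ≤ (0 : ℕ) from lt_of_le_of_lt this (by simp)
  -- A chain `q' < q < p` pulls back to primes over `I`, starting in height at least two and so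
  -- reaching four.
  refine Ideal.height_le_iff.2 fun q' hq' hq'q ↦ ?_
  exfalso
  have h2 : 2 ≤ (q'.comap (Ideal.Quotient.mk I)).height :=
    hI.trans <| Ideal.height_mono fun x hx ↦ by
    rw [Ideal.mem_comap, Ideal.Quotient.eq_zero_iff_mem.2 hx]; exact q'.zero_mem
  have h3 := hlt hq'q
  have h4 := hlt hqp
  have h5 := height_le_three (p.comap (Ideal.Quotient.mk I))
  have h6 := (add_le_add_left ((add_le_add_left h2 1).trans h3) 1).trans (h4.trans h5)
  exact absurd h6 (by decide)

theorem isArithmeticallyCM_of_forall {I : Ideal PolyRing} (hI : 2 ≤ I.height)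
    (h : ∀ (m : Ideal PolyRing) [m.IsMaximal], ∀ s, (∀ r ∈ m, r * s ∈ I) → s ∈ I) :
    IsArithmeticallyCM I := by
  refine isCohenMacaulayRing_of_ringKrullDim_le_one (ringKrullDim_quotient_le_one hI)
    fun m hm s hs ↦ ?_
  obtain ⟨s, rfl⟩ := Ideal.Quotient.mk_surjective s
  have := Ideal.comap_isMaximal_of_surjective (K := m) _ (Ideal.Quotient.mk_surjective (I := I))
  rw [Ideal.Quotient.eq_zero_iff_mem]
  refine h (m.comap (Ideal.Quotient.mk I)) s fun r hr ↦ ?_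
  rw [← Ideal.Quotient.eq_zero_iff_mem, map_mul]
  exact hs _ hr

/-- The origin is not an isolated point of a homogeneous ideal of height two. -/
theorem idealOfVars_notMem_minimalPrimes {ι : Type*} {f : ι → PolyRing}
    (hf : ∀ i, ∃ n, (f i).IsHomogeneous n) (hI : (Ideal.span (Set.range f)).height = 2) :
    idealOfVars (Fin 3) ℂ ∉ (Ideal.span (Set.range f)).minimalPrimes := by
  intro hmin
  have h3 : 3 ≤ (Ideal.span (Set.range f)).height := by
    rw [Ideal.height_eq_inf_minimalPrimes]
    refine le_iInf₂ fun J hJ ↦ ?_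
    rw [← height_idealOfVars]
    exact Ideal.height_mono (hmin.2 hJ.1 (minimalPrimes_span_le_idealOfVars hf hJ))
  rw [hI] at h3
  exact absurd h3 (by decide)

theorem mul_mem_of_mem_idealOfVars {σ K : Type*} [CommRing K] {I : Ideal (MvPolynomial σ K)}
    {s r : MvPolynomial σ K} (hs : ∀ i, X i * s ∈ I) (hr : r ∈ idealOfVars σ K) : r * s ∈ I := by
  refine Submodule.span_induction (p := fun r _ ↦ r * s ∈ I) ?_ (by simp) ?_ ?_ hr
  · rintro _ ⟨i, rfl⟩
    exact hs i
  · intro a b _ _ ha hb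
    rw [add_mul]; exact add_mem ha hb
  · intro a b _ hb
    rw [smul_eq_mul, mul_assoc]; exact I.mul_mem_left _ hb

/-- The origin lies strictly above a minimal prime of the ideal, so it has positive height in the
quotient, and a socle element vanishes locally there. -/
theorem IsArithmeticallyCM.mem_of_forall_mul_mem {ι : Type*} {f : ι → PolyRing}
    (hf : ∀ i, ∃ n, (f i).IsHomogeneous n) (hI : (Ideal.span (Set.range f)).height = 2)
    (hCM : IsArithmeticallyCM (Ideal.span (Set.range f))) {s : PolyRing}
    (hs : ∀ i, X i * s ∈ Ideal.span (Set.range f)) : s ∈ Ideal.span (Set.range f) := by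
  set I := Ideal.span (Set.range f) with hIdef
  have hmax := idealOfVars_isMaximal (Fin 3) ℂ
  have hne : I ≠ ⊤ := by rintro h; simp [h] at hI
  obtain ⟨p, hp⟩ := Ideal.nonempty_minimalPrimes hne
  have := hp.1.1
  have hpm : p < idealOfVars (Fin 3) ℂ :=
    lt_of_le_of_ne (minimalPrimes_span_le_idealOfVars hf hp) fun h ↦
      idealOfVars_notMem_minimalPrimes hf hI (h ▸ hp)
  have hsurj := Ideal.Quotient.mk_surjective (I := I)
  have hcomap : ∀ q : Ideal PolyRing, I ≤ q →
      (q.map (Ideal.Quotient.mk I)).comap (Ideal.Quotient.mk I) = q := fun q hq ↦ by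
    rw [Ideal.comap_map_of_surjective' _ hsurj, Ideal.mk_ker, sup_eq_left.2 hq]
  have hpP : (p.map (Ideal.Quotient.mk I)).IsPrime :=
    Ideal.map_isPrime_of_surjective hsurj (by simpa using hp.1.2)
  have hIm : I ≤ idealOfVars (Fin 3) ℂ := hp.1.2.trans hpm.le
  have hmP : ((idealOfVars (Fin 3) ℂ).map (Ideal.Quotient.mk I)).IsMaximal := by
    refine (Ideal.map_eq_top_or_isMaximal_of_surjective _ hsurj hmax).resolve_left fun h ↦ ?_
    have := hcomap _ hIm
    rw [h, Ideal.comap_top] at this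
    exact hmax.ne_top this.symm
  have hlt : p.map (Ideal.Quotient.mk I) < (idealOfVars (Fin 3) ℂ).map (Ideal.Quotient.mk I) := by
    refine lt_of_le_of_ne (Ideal.map_mono hpm.le) fun h ↦ hpm.ne ?_
    rw [← hcomap p hp.1.2, h, hcomap _ hIm]
  have h1 := le_add_self.trans (Ideal.height_add_one_le_of_lt_of_isPrime hlt)
  obtain ⟨t, ht, hts⟩ := IsCohenMacaulayRing.exists_mul_eq_zero hCM
    ((idealOfVars (Fin 3) ℂ).map (Ideal.Quotient.mk I)) h1 (s := Ideal.Quotient.mk I s) (by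
      intro r hr
      obtain ⟨r, rfl⟩ := hsurj r
      rw [← Ideal.mem_comap, hcomap _ hIm] at hr
      rw [← map_mul, Ideal.Quotient.eq_zero_iff_mem]
      exact mul_mem_of_mem_idealOfVars hs hr)
  obtain ⟨t, rfl⟩ := hsurj t
  rw [← map_mul, Ideal.Quotient.eq_zero_iff_mem] at hts
  -- Both `t` and its part without constant term send `s` into `I`, hence so does the nonzero
  -- constant.
  have ht0 : coeff 0 t ≠ 0 := fun h ↦ ht (Ideal.mem_map_of_mem _ (mem_idealOfVars_iff.2 h))
  have hdiff : (t - C (coeff 0 t)) * s ∈ I :=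
    mul_mem_of_mem_idealOfVars hs (by rw [mem_idealOfVars_iff]; simp)
  have h3 : C (coeff 0 t) * s ∈ I := by
    have := I.sub_mem hts hdiff
    rwa [← sub_mul, sub_sub_cancel] at this
  have h4 := I.mul_mem_left (C (coeff 0 t)⁻¹) h3
  rwa [← mul_assoc, ← C_mul, inv_mul_cancel₀ ht0, C_1, one_mul] at h4

/-! ### Hilbert–Burch, from minors to syzygies -/

open scoped Matrix

theorem range_linearCombination_eq_span {R ι : Type*} [CommRing R] [Fintype ι] (f : ι → R) :
    LinearMap.range (Fintype.linearCombination R f) = Ideal.span (Set.range f) :=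
  Fintype.range_linearCombination R f

theorem mul_eq_mul_of_cross_eq_zero {R : Type*} [CommRing R] {v w : Fin 3 → R}
    (h : v ⨯₃ w = 0) (i j : Fin 3) : v i * w j = v j * w i := by
  rw [cross_apply] at h
  have h0 := congrFun h 0
  have h1 := congrFun h 1
  have h2 := congrFun h 2
  simp at h0 h1 h2
  fin_cases i <;> fin_cases j <;> simp <;>
    first
    | ring
    | linear_combination h0
    | linear_combination -h0
    | linear_combination h1
    | linear_combination -h1
    | linear_combination h2
    | linear_combination -h2

section HilbertBurch

variable {R : Type*} [CommRing R] [IsDomain R]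

/-- Columns with a nonzero minor are linearly independent. -/
theorem injective_linearCombination_pair {v w : Fin 3 → R} (h : v ⨯₃ w ≠ 0) :
    Function.Injective (Fintype.linearCombination R ![v, w]) := by
  obtain ⟨k, hk⟩ := Function.ne_iff.1 h
  rw [injective_iff_map_eq_zero]
  intro a ha
  simp only [Fintype.linearCombination_apply, Fin.sum_univ_two, Matrix.cons_val_zero,
    Matrix.cons_val_one] at ha
  have hv : a 1 • (v ⨯₃ w) = 0 := by
    have := congrArg (fun t ↦ v ⨯₃ t) ha
    simpa using this
  have hw : a 0 • (v ⨯₃ w) = 0 := by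
    have := congrArg (fun t ↦ t ⨯₃ w) ha
    simpa using this
  funext i
  fin_cases i
  · exact (mul_eq_zero.1 (congrFun hw k)).resolve_right hk
  · exact (mul_eq_zero.1 (congrFun hv k)).resolve_right hk

/-- The easy half of the Hilbert–Burch theorem: the columns of a `3 × 2` matrix whose minors have
no common factor generate the syzygies of the minors. -/
theorem exact_linearCombination_cross [UniqueFactorizationMonoid R] {v w : Fin 3 → R}
    (hf : ∀ π, Prime π → ∃ i, ¬ π ∣ (v ⨯₃ w) i) (hne : v ⨯₃ w ≠ 0) :
    Function.Exact (Fintype.linearCombination R ![v, w])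
      (Fintype.linearCombination R (v ⨯₃ w)) := by
  intro p
  simp only [Fintype.linearCombination_apply, Fin.sum_univ_two, Fin.sum_univ_three, smul_eq_mul,
    Matrix.cons_val_zero, Matrix.cons_val_one, Set.mem_range]
  constructor
  · intro hp
    -- Cramer's rule: since `p` is orthogonal to `v ⨯₃ w`, both `p ⨯₃ w` and `v ⨯₃ p` are parallel
    -- to it, and coprimality of the minors puts the coefficients `α`, `β` in `R`.
    obtain ⟨α, hα⟩ := exists_eq_smul_of_mul_eq_mul (c := p ⨯₃ w) hf hne <| by
      apply mul_eq_mul_of_cross_eq_zero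
      simp only [cross_apply] at hp ⊢
      simp at hp
      funext i
      fin_cases i <;> simp
      · linear_combination -w 0 * hp
      · linear_combination -w 1 * hp
      · linear_combination -w 2 * hp
    obtain ⟨β, hβ⟩ := exists_eq_smul_of_mul_eq_mul (c := v ⨯₃ p) hf hne <| by
      apply mul_eq_mul_of_cross_eq_zero
      simp only [cross_apply] at hp ⊢
      simp at hp
      funext i
      fin_cases i <;> simp
      · linear_combination v 0 * hp
      · linear_combination v 1 * hp
      · linear_combination v 2 * hp
    refine ⟨![α, β], ?_⟩
    simp only [Matrix.cons_val_zero, Matrix.cons_val_one]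
    rw [← sub_eq_zero]
    set q := α • v + β • w - p with hq
    have h1 : q ⨯₃ w = 0 := by simp [hq, hα]
    have h2 : v ⨯₃ q = 0 := by simp [hq, hβ]
    obtain ⟨k, hk⟩ := Function.ne_iff.1 hne
    have h1' := mul_eq_mul_of_cross_eq_zero h1
    have h2' := mul_eq_mul_of_cross_eq_zero h2
    funext i
    refine (mul_eq_zero.1 (?_ : (v ⨯₃ w) k * q i = 0)).resolve_left hk
    have key : ∀ a b, (v a * w b - v b * w a) * q i = 0 := fun a b ↦ by
      linear_combination w b * h2' a i - w a * h2' b i + v i * h1' a b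
    rw [cross_apply]
    fin_cases k <;> simp [key]
  · rintro ⟨a, rfl⟩
    simp [cross_apply]
    ring

end HilbertBurch

/-- A perfect ideal of grade at most two has no socle at any closed point. -/
theorem mem_range_of_forall_mem_isMaximal {ι κ : Type*}
    {L : (κ → PolyRing) →ₗ[PolyRing] (ι → PolyRing)} {F : (ι → PolyRing) →ₗ[PolyRing] PolyRing}
    (hLF : Function.Exact L F)
    (hL : Function.Injective L) (m : Ideal PolyRing) [m.IsMaximal] {s : PolyRing}
    (hs : ∀ r ∈ m, r * s ∈ LinearMap.range F) : s ∈ LinearMap.range F := by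
  obtain ⟨e, he⟩ := exists_ringEquiv_comap_eq_idealOfVars m
  have hX : ∀ i, e (X i) ∈ m := fun i ↦ by
    rw [← Ideal.mem_comap, he]
    exact Ideal.subset_span ⟨i, rfl⟩
  exact (isRegularTriple_X.map e).mem_range_of_exact hLF hL (hs _ (hX 0)) (hs _ (hX 1))
    (hs _ (hX 2))

/-- The Koszul complex exhibits `f` as the minors of a matrix with first column `A`, so `f` has a
free resolution of length two. -/
theorem isArithmeticallyCM_of_isRegularTriple {f A : Fin 3 → PolyRing}
    (hI : (Ideal.span (Set.range f)).height = 2) (hA : IsRegularTriple (A 0) (A 1) (A 2))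
    (hAf : A 0 * f 0 + A 1 * f 1 + A 2 * f 2 = 0) :
    IsArithmeticallyCM (Ideal.span (Set.range f)) := by
  obtain ⟨u, v, w, h0, h1, h2⟩ := hA.exists_cross hAf
  have hf : f = A ⨯₃ ![u, v, w] := by
    rw [cross_apply]
    funext i
    fin_cases i <;> simp [h0, h1, h2]
  have hne : f ≠ 0 := by
    rintro rfl
    have : Set.range (0 : Fin 3 → PolyRing) = {0} := Set.range_const
    rw [this, Ideal.span_singleton_zero, Ideal.height_bot] at hI
    exact absurd hI (by decide)
  have hcop := exists_not_dvd_of_two_le_height hI.ge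
  refine isArithmeticallyCM_of_forall hI.ge fun m _ s hs ↦ ?_
  rw [← range_linearCombination_eq_span] at hs ⊢
  rw [hf] at hs ⊢ hne hcop
  exact mem_range_of_forall_mem_isMaximal (exact_linearCombination_cross hcop hne)
    (injective_linearCombination_pair hne) m hs

/-! ### Minimal homogeneous syzygies -/

theorem MvPolynomial.homogeneousComponent_mul_of_isHomogeneous {σ K : Type*} [CommRing K]
    (a : MvPolynomial σ K) {b : MvPolynomial σ K} {k : ℕ} (hb : b.IsHomogeneous k) (n : ℕ) :
    homogeneousComponent n (a * b) =
      (if k ≤ n then homogeneousComponent (n - k) a else 0) * b := by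
  have h := DirectSum.coe_decompose_mul_of_right_mem (homogeneousSubmodule σ K) (a := a) (b := b)
    (i := k) n hb
  have hd : ∀ (p : MvPolynomial σ K) i,
      ((DirectSum.decompose (homogeneousSubmodule σ K) p i : _) : MvPolynomial σ K)
        = homogeneousComponent i p := fun p i ↦ decomposition.decompose'_apply p i
  rw [hd, hd] at h
  rw [h]
  split_ifs <;> simp

theorem MvPolynomial.sum_range_homogeneousComponent {σ K : Type*} [CommRing K]
    (a : MvPolynomial σ K) {N : ℕ} (hN : a.totalDegree < N) :
    ∑ n ∈ Finset.range N, homogeneousComponent n a = a := by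
  conv_rhs => rw [← sum_homogeneousComponent a]
  refine (Finset.sum_subset (by simpa using hN) fun n _ hn ↦ ?_).symm
  exact homogeneousComponent_eq_zero _ _ (by simpa using hn)

theorem span_X_triple_eq_idealOfVars {K : Type*} [CommRing K] :
    Ideal.span {(X 0 : MvPolynomial (Fin 3) K), X 1, X 2} = idealOfVars (Fin 3) K := by
  rw [idealOfVars]
  congr 1
  ext p
  simp [Fin.exists_fin_succ, eq_comm]

section Syzygies

variable {σ K ι : Type*} [Field K]

/-- The vectors of polynomials with homogeneous entries of one degree. -/
def IsHomogeneousVector (v : ι → MvPolynomial σ K) : Prop :=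
  ∃ n, ∀ i, (v i).IsHomogeneous n

/-- A homogeneous relation with a unit coefficient makes a generator redundant. -/
theorem mem_span_erase_of_relation [DecidableEq (ι → MvPolynomial σ K)]
    {T : Finset (ι → MvPolynomial σ K)}
    (hT : ∀ t ∈ T, IsHomogeneousVector t) {a : T → MvPolynomial σ K}
    (ha : ∑ t, a t • (t : ι → MvPolynomial σ K) = 0) (t₀ : T) (h0 : coeff 0 (a t₀) ≠ 0) :
    (t₀ : ι → MvPolynomial σ K) ∈
      Submodule.span (MvPolynomial σ K) (T.erase t₀ : Set (ι → MvPolynomial σ K)) := by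
  have : ∀ t : T, ∃ n, ∀ i, (t.1 i).IsHomogeneous n := fun t ↦ hT t t.2
  choose e he using this
  -- The degree `e t₀` part of the relation is again a relation, with a nonzero constant at `t₀`;
  -- the test guards against truncated subtraction.
  set r : T → MvPolynomial σ K :=
    fun t ↦ if e t ≤ e t₀ then homogeneousComponent (e t₀ - e t) (a t) else 0 with hr
  have hsum : ∑ t, r t • (t : ι → MvPolynomial σ K) = 0 := by
    funext i
    have := congrArg (homogeneousComponent (e t₀)) (congrFun ha i)
    simp only [Finset.sum_apply, Pi.smul_apply, smul_eq_mul, map_sum, Pi.zero_apply, map_zero]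
      at this ⊢
    rw [← this]
    refine Finset.sum_congr rfl fun t _ ↦ ?_
    rw [homogeneousComponent_mul_of_isHomogeneous _ (he t i)]
  have hr0 : r t₀ = C (coeff 0 (a t₀)) := by
    simp [hr, homogeneousComponent_zero]
  rw [← Finset.add_sum_erase _ _ (Finset.mem_univ t₀), hr0] at hsum
  have hmem : ∑ t ∈ Finset.univ.erase t₀, r t • (t : ι → MvPolynomial σ K) ∈
      Submodule.span (MvPolynomial σ K) (T.erase t₀ : Set (ι → MvPolynomial σ K)) := by
    refine Submodule.sum_mem _ fun t ht ↦ Submodule.smul_mem _ _ (Submodule.subset_span ?_)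
    exact Finset.mem_erase.2 ⟨fun h ↦ (Finset.mem_erase.1 ht).1 (Subtype.ext h), t.2⟩
  have hCt : (C (coeff 0 (a t₀)) : MvPolynomial σ K) • (t₀ : ι → MvPolynomial σ K) ∈
      Submodule.span (MvPolynomial σ K) (T.erase t₀ : Set (ι → MvPolynomial σ K)) := by
    rw [eq_neg_of_add_eq_zero_left hsum]
    exact neg_mem hmem
  have := Submodule.smul_mem _ (C (coeff 0 (a t₀))⁻¹) hCt
  rwa [smul_smul, ← C_mul, inv_mul_cancel₀ h0, C_1, one_smul] at this

variable [Fintype ι] {f : ι → MvPolynomial σ K} {d : ℕ}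

/-- As all `f i` have degree `d`, the degree `n` part of a syzygy contributes exactly the degree `n
+ d` part of the relation. -/
theorem span_homogeneous_syzygies_eq_ker (hf : ∀ i, (f i).IsHomogeneous d) :
    Submodule.span (MvPolynomial σ K)
      {v | Fintype.linearCombination (MvPolynomial σ K) f v = 0 ∧ IsHomogeneousVector v} =
      LinearMap.ker (Fintype.linearCombination (MvPolynomial σ K) f) := by
  refine le_antisymm (Submodule.span_le.2 fun v hv ↦ hv.1) fun v hv ↦ ?_
  set N := Finset.univ.sup (fun i ↦ (v i).totalDegree) + 1 with hN
  have hv' : v = ∑ n ∈ Finset.range N, fun i ↦ homogeneousComponent n (v i) := by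
    funext i
    rw [Finset.sum_apply, sum_range_homogeneousComponent]
    rw [hN, Nat.lt_succ_iff]
    exact Finset.le_sup (f := fun i ↦ (v i).totalDegree) (Finset.mem_univ i)
  rw [hv']
  refine Submodule.sum_mem _ fun n _ ↦ Submodule.subset_span
    ⟨?_, n, fun i ↦ homogeneousComponent_isHomogeneous n (v i)⟩
  have := congrArg (homogeneousComponent (n + d)) (LinearMap.mem_ker.1 hv)
  simp only [Fintype.linearCombination_apply, smul_eq_mul, map_sum, map_zero] at this ⊢
  rw [← this]
  refine Finset.sum_congr rfl fun i _ ↦ ?_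
  simp [homogeneousComponent_mul_of_isHomogeneous _ (hf i)]

/-- Homogeneous polynomials of the same degree have a finite homogeneous generating set of
syzygies whose relations have coefficients without constant term. -/
theorem exists_minimal_homogeneous_syzygies [Finite σ] (hf : ∀ i, (f i).IsHomogeneous d) :
    ∃ T : Finset (ι → MvPolynomial σ K), (∀ t ∈ T, IsHomogeneousVector t) ∧
      Submodule.span (MvPolynomial σ K) (T : Set (ι → MvPolynomial σ K)) =
        LinearMap.ker (Fintype.linearCombination (MvPolynomial σ K) f) ∧
      ∀ a : T → MvPolynomial σ K, ∑ t, a t • (t : ι → MvPolynomial σ K) = 0 →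
        ∀ t, a t ∈ idealOfVars σ K := by
  classical
  set H : Set (ι → MvPolynomial σ K) :=
    {v | Fintype.linearCombination (MvPolynomial σ K) f v = 0 ∧ IsHomogeneousVector v}
  have hH := span_homogeneous_syzygies_eq_ker hf
  -- Minimality is by cardinality: a coefficient with nonzero constant term would allow a generator
  -- to be erased.
  have hex : ∃ c, ∃ T : Finset (ι → MvPolynomial σ K), (T : Set _) ⊆ H ∧
      Submodule.span (MvPolynomial σ K) (T : Set (ι → MvPolynomial σ K)) =
        LinearMap.ker (Fintype.linearCombination (MvPolynomial σ K) f) ∧ T.card = c := by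
    obtain ⟨T, hTH, hT⟩ := (Submodule.fg_span_iff_fg_span_finset_subset H).1
      (hH ▸ IsNoetherian.noetherian
        (LinearMap.ker (Fintype.linearCombination (MvPolynomial σ K) f)))
    exact ⟨_, T, hTH, hT.symm.trans hH, rfl⟩
  obtain ⟨T, hTH, hT, hcard⟩ := Nat.find_spec hex
  have hThom : ∀ t ∈ T, IsHomogeneousVector t := fun t ht ↦ (hTH ht).2
  refine ⟨T, hThom, hT, fun a ha t ↦ ?_⟩
  rw [mem_idealOfVars_iff]
  by_contra h0
  have hmem := mem_span_erase_of_relation hThom ha t h0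
  refine Nat.find_min hex (m := (T.erase t).card) ?_ ⟨T.erase t, ?_, ?_, rfl⟩
  · rw [← hcard]
    exact Finset.card_erase_lt_of_mem t.2
  · exact fun x hx ↦ hTH (Finset.mem_of_mem_erase hx)
  · rw [← hT]
    conv_rhs => rw [← Finset.insert_erase t.2, Finset.coe_insert,
      Submodule.span_insert_eq_span hmem]

end Syzygies

/-- The graded Hilbert–Burch theorem: the syzygies of three forms of the same degree generating an
ideal without socle at the origin are free of rank two on homogeneous syzygies. -/
theorem exists_homogeneous_syzygy_basis {f : Fin 3 → PolyRing}
    {d : ℕ} (hf : ∀ i, (f i).IsHomogeneous d) (hne : f ≠ 0)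
    (hsoc : ∀ s, (∀ i, X i * s ∈ Ideal.span (Set.range f)) → s ∈ Ideal.span (Set.range f)) :
    ∃ v w : Fin 3 → PolyRing, ∃ m n, m ≤ n ∧
      (∀ i, (v i).IsHomogeneous m) ∧ (∀ i, (w i).IsHomogeneous n) ∧
      Function.Exact (Fintype.linearCombination PolyRing ![v, w])
        (Fintype.linearCombination PolyRing f) ∧
      Function.Injective (Fintype.linearCombination PolyRing ![v, w]) := by
  classical
  obtain ⟨T, hThom, hT, hrel⟩ := exists_minimal_homogeneous_syzygies hf
  set F := Fintype.linearCombination PolyRing f with hF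
  set L := Fintype.linearCombination PolyRing (fun t : T ↦ (t : Fin 3 → PolyRing)) with hL
  have hrange : LinearMap.range L = LinearMap.ker F := by
    rw [hL, Fintype.range_linearCombination, ← hT]
    simp
  have hLF : Function.Exact L F := LinearMap.exact_iff.2 hrange.symm
  have hinj : Function.Injective L := by
    refine isRegularTriple_X.injective_of_exact ?_ hLF ?_ ?_
    · rw [span_X_triple_eq_idealOfVars]
      exact (idealOfVars_isMaximal _ _).ne_top
    · rw [span_X_triple_eq_idealOfVars]
      exact hrel
    · rw [range_linearCombination_eq_span]
      intro s h0 h1 h2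
      refine hsoc s fun i ↦ ?_
      fin_cases i <;> assumption
  -- Rank count: the image of `F` is a nonzero ideal, of rank one, so the free kernel has rank `3 -
  -- 1`.
  have hcard : T.card = 2 := by
    have h1 : Module.finrank PolyRing (LinearMap.range F) = 1 := by
      refine le_antisymm ((Submodule.finrank_le _).trans (Module.finrank_self PolyRing).le) ?_
      have hbot : LinearMap.range F ≠ ⊥ := by
        rw [hF, range_linearCombination_eq_span]
        intro h
        exact hne (_root_.funext fun i ↦ (Ideal.span_eq_bot.1 h) (f i) ⟨i, rfl⟩)
      have : Nontrivial (LinearMap.range F) := (Submodule.nontrivial_iff_ne_bot).2 hbot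
      exact Module.finrank_pos
    have h2 : Module.finrank PolyRing (LinearMap.range F) +
        Module.finrank PolyRing (LinearMap.ker F) = 3 := by
      have := (Submodule.finrank_quotient_add_finrank (LinearMap.ker F))
      rw [F.quotKerEquivRange.finrank_eq] at this
      simpa using this
    have h3 : Module.finrank PolyRing (LinearMap.ker F) = T.card := by
      rw [← hrange, LinearMap.finrank_range_of_inj hinj]
      simp
    omega
  have key : ∀ v w : Fin 3 → PolyRing, v ≠ w → T = {v, w} →
      Function.Exact (Fintype.linearCombination PolyRing ![v, w]) F ∧
      Function.Injective (Fintype.linearCombination PolyRing ![v, w]) := by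
    intro v w hvw hTvw
    have hli : LinearIndependent PolyRing (fun t : T ↦ (t : Fin 3 → PolyRing)) := by
      exact linearIndependent_iff_injective_fintypeLinearCombination.2 hinj
    refine ⟨LinearMap.exact_iff.2 ?_, ?_⟩
    · rw [Fintype.range_linearCombination, ← hT, hTvw]
      simp [Set.pair_comm]
    · rw [← linearIndependent_iff_injective_fintypeLinearCombination]
      have hv : v ∈ T := by simp [hTvw]
      have hw : w ∈ T := by simp [hTvw]
      have := hli.comp ![(⟨v, hv⟩ : T), ⟨w, hw⟩] (by
        intro i j hij
        fin_cases i <;> fin_cases j <;> simp_all)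
      convert this using 1
      funext i
      fin_cases i <;> rfl
  obtain ⟨v, w, hvw, hTvw⟩ := Finset.card_eq_two.1 hcard
  obtain ⟨m, hm⟩ := hThom v (by simp [hTvw])
  obtain ⟨n, hn⟩ := hThom w (by simp [hTvw])
  rcases le_total m n with h | h
  · exact ⟨v, w, m, n, h, hm, hn, key v w hvw hTvw⟩
  · exact ⟨w, v, n, m, h, hn, hm, key w v hvw.symm (by rw [hTvw, Finset.pair_comm])⟩

/-! ### Forms of codimension three -/

/-- Forms cutting out a locus of codimension three form a regular triple. -/
theorem isRegularTriple_of_three_le_height {x y z : PolyRing} {m : ℕ}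
    (hx : x.IsHomogeneous m) (hx0 : x ∈ idealOfVars (Fin 3) ℂ)
    (hy0 : y ∈ idealOfVars (Fin 3) ℂ) (hz0 : z ∈ idealOfVars (Fin 3) ℂ)
    (h : ∀ Q : Ideal PolyRing, Q.IsPrime → x ∈ Q → y ∈ Q → z ∈ Q → 3 ≤ Q.height) :
    IsRegularTriple x y z := by
  have hm := idealOfVars_isMaximal (Fin 3) ℂ
  have hpair : ∀ a b : PolyRing, a ∈ idealOfVars (Fin 3) ℂ → b ∈ idealOfVars (Fin 3) ℂ →
      ∃ Q : Ideal PolyRing, Q.IsPrime ∧ a ∈ Q ∧ b ∈ Q ∧ Q.height ≤ 2 := by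
    intro a b ha hb
    refine exists_isPrime_mem_mem_height_le_two (ne_top_of_le_ne_top hm.ne_top ?_)
    rw [Ideal.span_le]
    rintro _ (rfl | rfl) <;> assumption
  have hxne : x ≠ 0 := by
    rintro rfl
    obtain ⟨Q, hQ, hyQ, hzQ, hQ2⟩ := hpair y z hy0 hz0
    exact absurd ((h Q hQ Q.zero_mem hyQ hzQ).trans hQ2) (by decide)
  have hcop : ∀ π : PolyRing, Prime π → ∃ i, ¬ π ∣ ![x, y] i := by
    intro π hπ
    by_contra! hc
    -- A common factor `π` must be seen to vanish at the origin, to make `(π, z)` proper. The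
    -- homogeneous core of `(π)` contains `x`, hence a prime element, which is an associate of `π`.
    have hπP : (Ideal.span {π}).IsPrime := (Ideal.span_singleton_prime hπ.ne_zero).2 hπ
    obtain ⟨Q₁, hQ₁, hQ₁π, hQ₁m, hmem⟩ := exists_homogeneous_isPrime_le (Ideal.span {π})
    have hx1 := hmem x m hx (Ideal.mem_span_singleton.2 (hc 0))
    have hQ₁ne : Q₁ ≠ ⊥ := by
      rintro rfl
      exact hxne (by simpa using hx1)
    obtain ⟨π', hπ'Q, hπ'⟩ := hQ₁.exists_mem_prime_of_ne_bot hQ₁ne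
    have hdvd : π ∣ π' := Ideal.mem_span_singleton.1 (hQ₁π hπ'Q)
    have hassoc : Associated π π' := hπ.associated_of_dvd hπ' hdvd
    have hπm : π ∈ idealOfVars (Fin 3) ℂ := hQ₁m (Ideal.mem_of_dvd _ hassoc.dvd' hπ'Q)
    obtain ⟨Q, hQ, hπQ, hzQ, hQ2⟩ := hpair π z hπm hz0
    exact absurd ((h Q hQ (Ideal.mem_of_dvd _ (hc 0) hπQ) (Ideal.mem_of_dvd _ (hc 1) hπQ)
      hzQ).trans hQ2) (by decide)
  have hsecond : ∀ a b, y * a = x * b → ∃ c, a = x * c := by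
    intro a b hab
    obtain ⟨g, hg⟩ := exists_eq_smul_of_mul_eq_mul (c := ![a, b]) hcop
      (fun h0 ↦ hxne (congrFun h0 0)) (by
        intro i j
        fin_cases i <;> fin_cases j <;> simp [hab])
    exact ⟨g, by simpa [mul_comm] using congrFun hg 0⟩
  refine ⟨fun a ha ↦ (mul_eq_zero.1 ha).resolve_left hxne, hsecond, fun a b c habc ↦ ?_⟩
  set J := Ideal.span (Set.range ![x, y]) with hJ
  have hmemJ : ∀ p, p ∈ J ↔ ∃ d e, p = x * d + y * e := fun p ↦ by
    have : Set.range ![x, y] = {x, y} := by simp [Set.pair_comm]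
    rw [hJ, this, Ideal.mem_span_pair]
    simp only [mul_comm, eq_comm]
  rw [← hmemJ]
  by_contra haJ
  have ha0 : Ideal.Quotient.mk J a ≠ 0 := fun h0 ↦ haJ (Ideal.Quotient.eq_zero_iff_mem.1 h0)
  -- If `z` kills a nonzero class modulo `(x, y)`, it lies in an associated prime `P`, which has
  -- height three and is maximal; the Koszul resolution of `(x, y)` excludes such a socle.
  obtain ⟨P, hP, hle⟩ := exists_le_isAssociatedPrime_of_isNoetherianRing PolyRing
    (Ideal.Quotient.mk J a) ha0
  obtain ⟨hPp, s, hPs⟩ := isAssociatedPrime_iff.1 hP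
  obtain ⟨s, rfl⟩ := Ideal.Quotient.mk_surjective s
  have hcolon : ∀ (r t : PolyRing),
      r ∈ Submodule.colon (⊥ : Submodule PolyRing (PolyRing ⧸ J)) {Ideal.Quotient.mk J t} ↔
        r * t ∈ J := fun r t ↦ by
    rw [Submodule.mem_colon_singleton, Submodule.mem_bot, ← Ideal.Quotient.eq_zero_iff_mem]
    rfl
  have hzP : z ∈ P := hle ((hcolon z a).2 ((hmemJ _).2 ⟨b, c, habc⟩))
  have hJP : J ≤ P := fun r hr ↦ by
    rw [hPs, hcolon]
    exact J.mul_mem_right _ hr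
  have := isMaximal_of_three_le_height P (h P hPp (hJP ((hmemJ x).2 ⟨1, 0, by ring⟩))
    (hJP ((hmemJ y).2 ⟨0, 1, by ring⟩)) hzP)
  set F := Fintype.linearCombination PolyRing ![x, y] with hF
  set L := Fintype.linearCombination PolyRing (fun _ : Fin 1 ↦ ![y, -x]) with hL
  have hLF : Function.Exact L F := by
    intro p
    simp only [hF, hL, Fintype.linearCombination_apply, Fin.sum_univ_two, Set.mem_range,
      Finset.univ_unique, Finset.sum_singleton, smul_eq_mul, Matrix.cons_val_zero,
      Matrix.cons_val_one]
    constructor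
    · intro hp
      obtain ⟨q, hq⟩ := hsecond (p 1) (-p 0) (by linear_combination hp)
      refine ⟨fun _ ↦ -q, ?_⟩
      funext i
      fin_cases i
      · simp only [Fin.zero_eta, Pi.smul_apply, smul_eq_mul, Matrix.cons_val_zero]
        refine mul_left_cancel₀ hxne ?_
        linear_combination -hp + y * hq
      · simp [hq, mul_comm]
    · rintro ⟨q, rfl⟩
      simp
      ring
  have hLinj : Function.Injective L := by
    rw [injective_iff_map_eq_zero]
    intro q hq
    funext i
    have := congrFun hq 1
    simp [hL, Fintype.linearCombination_apply, hxne] at this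
    rwa [Subsingleton.elim i 0]
  have hsJ : s ∈ J := by
    rw [hJ, ← range_linearCombination_eq_span]
    refine mem_range_of_forall_mem_isMaximal hLF hLinj P fun r hr ↦ ?_
    rw [range_linearCombination_eq_span]
    rwa [hPs, hcolon] at hr
  apply hPp.ne_top
  rw [hPs, Ideal.eq_top_iff_one, hcolon]
  simpa using hsJ

/-! ### Hilbert–Burch, from syzygies to minors -/

section Minors

variable {R : Type*} [CommRing R] [IsDomain R] [UniqueFactorizationMonoid R]

/-- The maximal minors of a basis of the syzygies of three elements without common factor are
these elements, up to a unit. -/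
theorem exists_isUnit_cross_eq_smul {f v w : Fin 3 → R} (hf : ∀ π, Prime π → ∃ i, ¬ π ∣ f i)
    (hne : f ≠ 0)
    (hex : Function.Exact (Fintype.linearCombination R ![v, w]) (Fintype.linearCombination R f))
    (hinj : Function.Injective (Fintype.linearCombination R ![v, w])) :
    ∃ g : R, IsUnit g ∧ v ⨯₃ w = g • f := by
  have hL : ∀ a, Fintype.linearCombination R ![v, w] a = a 0 • v + a 1 • w := fun a ↦ by
    simp [Fintype.linearCombination_apply]
  have hF : ∀ p, Fintype.linearCombination R f p = p 0 * f 0 + p 1 * f 1 + p 2 * f 2 := fun p ↦ by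
    simp [Fintype.linearCombination_apply, Fin.sum_univ_three]
  have hindep : ∀ a b : R, a • v + b • w = 0 → a = 0 ∧ b = 0 := by
    intro a b hab
    have := hinj (a₁ := ![a, b]) (a₂ := 0) (by rw [hL, map_zero]; simpa using hab)
    exact ⟨congrFun this 0, congrFun this 1⟩
  have hgen : ∀ p : Fin 3 → R, p 0 * f 0 + p 1 * f 1 + p 2 * f 2 = 0 →
      ∃ a b : R, p = a • v + b • w := by
    intro p hp
    obtain ⟨a, ha⟩ := (hex p).1 (by rw [hF, hp])
    exact ⟨a 0, a 1, by rw [← ha, hL]⟩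
  have hv : v 0 * f 0 + v 1 * f 1 + v 2 * f 2 = 0 := by
    rw [← hF]; exact (hex v).2 ⟨![1, 0], by simp [hL]⟩
  have hw : w 0 * f 0 + w 1 * f 1 + w 2 * f 2 = 0 := by
    rw [← hF]; exact (hex w).2 ⟨![0, 1], by simp [hL]⟩
  obtain ⟨g, hg⟩ := exists_eq_smul_of_mul_eq_mul (c := v ⨯₃ w) hf hne <| by
    apply mul_eq_mul_of_cross_eq_zero
    simp only [cross_apply]
    funext i
    fin_cases i <;> simp
    · linear_combination v 0 * hw - w 0 * hv
    · linear_combination v 1 * hw - w 1 * hv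
    · linear_combination v 2 * hw - w 2 * hv
  refine ⟨g, ?_, hg⟩
  have hminor : ∀ i j, g ∣ v i * w j - w i * v j := by
    have h0 := congrFun hg 0
    have h1 := congrFun hg 1
    have h2 := congrFun hg 2
    simp [cross_apply] at h0 h1 h2
    intro i j
    fin_cases i <;> fin_cases j <;> simp
    · exact ⟨0, by ring⟩
    · exact ⟨f 2, by linear_combination h2⟩
    · exact ⟨-f 1, by linear_combination -h1⟩
    · exact ⟨-f 2, by linear_combination -h2⟩
    · exact ⟨0, by ring⟩
    · exact ⟨f 0, by linear_combination h0⟩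
    · exact ⟨f 1, by linear_combination h1⟩
    · exact ⟨-f 0, by linear_combination -h0⟩
    · exact ⟨0, by ring⟩
  have hvne : v ≠ 0 := by
    rintro rfl
    exact one_ne_zero (hindep 1 0 (by simp)).1
  by_contra hunit
  have hg0 : g ≠ 0 := by
    rintro rfl
    obtain ⟨i, hi⟩ := Function.ne_iff.1 hvne
    refine hi (hindep (-w i) (v i) (_root_.funext fun j ↦ ?_)).2
    have := zero_dvd_iff.1 (hminor i j)
    simp only [Pi.add_apply, Pi.smul_apply, smul_eq_mul, Pi.zero_apply]
    linear_combination this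
  obtain ⟨π, hπirr, hπg⟩ := WfDvdMonoid.exists_irreducible_factor hunit hg0
  have hπ := hπirr.prime
  -- Modulo `π` the columns are dependent: either `v` vanishes, or `v i • w - w i • v` does with `v
  -- i` nonzero. Divided by `π` this is a syzygy, and expanding it in the basis makes `π` divide `1`
  -- or `v i`.
  by_cases hdiv : ∀ i, π ∣ v i
  · choose p hp using hdiv
    obtain ⟨a, b, hab⟩ := hgen p (mul_left_cancel₀ hπ.ne_zero (by
      linear_combination hv - hp 0 * f 0 - hp 1 * f 1 - hp 2 * f 2))
    have := (hindep (π * a - 1) (π * b) (_root_.funext fun j ↦ by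
      have := congrFun hab j
      simp only [Pi.add_apply, Pi.smul_apply, smul_eq_mul, Pi.zero_apply] at this ⊢
      linear_combination -π * this - hp j)).1
    exact hπ.not_isUnit (IsUnit.of_mul_eq_one a (by linear_combination this))
  · push Not at hdiv
    obtain ⟨i, hi⟩ := hdiv
    choose p hp using fun j ↦ hπg.trans (hminor i j)
    obtain ⟨a, b, hab⟩ := hgen p (mul_left_cancel₀ hπ.ne_zero (by
      linear_combination v i * hw - w i * hv - hp 0 * f 0 - hp 1 * f 1 - hp 2 * f 2))
    have := (hindep (π * a + w i) (π * b - v i) (_root_.funext fun j ↦ by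
      have := congrFun hab j
      simp only [Pi.add_apply, Pi.smul_apply, smul_eq_mul, Pi.zero_apply] at this ⊢
      linear_combination -π * this - hp j)).2
    exact hi ⟨b, by linear_combination -this⟩

end Minors

/-! ### Local complete intersections and the general syzygy -/

/-- If three elements generate an ideal which needs only two generators at a prime, then they have
a syzygy with an entry outside this prime. -/
theorem exists_syzygy_notMem {R : Type*} [CommRing R] [IsDomain R] {f : Fin 3 → R} (p : Ideal R)
    [p.IsPrime] {a b : Localization.AtPrime p}
    (hab : (Ideal.span (Set.range f)).map (algebraMap R (Localization.AtPrime p)) =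
      Ideal.span {a, b}) :
    ∃ t : Fin 3 → R, t 0 * f 0 + t 1 * f 1 + t 2 * f 2 = 0 ∧ ∃ j, t j ∉ p := by
  set φ := algebraMap R (Localization.AtPrime p) with hφ
  rw [Ideal.map_span, ← Set.range_comp] at hab
  have h1 : ∀ i, ∃ u v, u * a + v * b = φ (f i) := fun i ↦ by
    rw [← Ideal.mem_span_pair, ← hab]
    exact Ideal.subset_span ⟨i, rfl⟩
  choose u v huv using h1
  have h2 : ∀ c ∈ ({a, b} : Set (Localization.AtPrime p)),
      ∃ α : Fin 3 → Localization.AtPrime p, ∑ i, α i * φ (f i) = c := fun c hc ↦ by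
    have : c ∈ Ideal.span (Set.range (φ ∘ f)) := hab ▸ Ideal.subset_span hc
    simpa using Ideal.mem_span_range_iff_exists_fun.1 this
  obtain ⟨α, hα⟩ := h2 a (by simp)
  obtain ⟨β, hβ⟩ := h2 b (by simp)
  rw [Fin.sum_univ_three] at hα hβ
  -- Rewriting the generators through `a`, `b` and back gives a matrix of rank at most two; the rows
  -- of its difference from the identity are syzygies. They cannot all vanish in the residue field,
  -- where the identity has rank three.
  set T : Fin 3 → Fin 3 → Localization.AtPrime p :=
    fun i j ↦ (if i = j then 1 else 0) - (u i * α j + v i * β j) with hT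
  have hTf : ∀ i, T i 0 * φ (f 0) + T i 1 * φ (f 1) + T i 2 * φ (f 2) = 0 := by
    intro i
    fin_cases i <;> simp [hT]
    · linear_combination -huv 0 - u 0 * hα - v 0 * hβ
    · linear_combination -huv 1 - u 1 * hα - v 1 * hβ
    · linear_combination -huv 2 - u 2 * hα - v 2 * hβ
  have hunit : ∃ i j, T i j ∉ IsLocalRing.maximalIdeal (Localization.AtPrime p) := by
    by_contra! hc
    set ρ := IsLocalRing.residue (Localization.AtPrime p)
    have hres : ∀ i j, ρ (u i) * ρ (α j) + ρ (v i) * ρ (β j) = if i = j then 1 else 0 := by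
      intro i j
      have := (IsLocalRing.residue_eq_zero_iff _).2 (hc i j)
      rw [hT, map_sub, sub_eq_zero] at this
      rw [← map_mul, ← map_mul, ← map_add, ← this]
      split_ifs <;> simp
    have hdet : ∀ x y z w : Fin 3 → IsLocalRing.ResidueField (Localization.AtPrime p),
        (Matrix.of fun i j ↦ x i * y j + z i * w j).det = 0 := fun x y z w ↦ by
      simp [Matrix.det_fin_three]
      ring
    have hone := hdet (fun i ↦ ρ (u i)) (fun j ↦ ρ (α j)) (fun i ↦ ρ (v i)) (fun j ↦ ρ (β j))
    simp [Matrix.det_fin_three, hres] at hone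
  obtain ⟨i, j, hij⟩ := hunit
  obtain ⟨c, hc⟩ := IsLocalization.exist_integer_multiples_of_finite p.primeCompl (T i)
  choose t ht using hc
  have ht' : ∀ k, φ (t k) = φ c * T i k := fun k ↦ by
    rw [ht, Algebra.smul_def]
  refine ⟨t, ?_, j, fun htj ↦ hij ?_⟩
  · apply IsLocalization.injective (Localization.AtPrime p) p.primeCompl_le_nonZeroDivisors
    simp only [map_add, map_mul, map_zero, ← hφ, ht']
    linear_combination φ c * hTf i
  · have h3 : φ (t j) ∈ IsLocalRing.maximalIdeal (Localization.AtPrime p) := by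
      rw [← Localization.AtPrime.map_eq_maximalIdeal]
      exact Ideal.mem_map_of_mem _ htj
    rw [ht'] at h3
    have hcu : IsUnit (φ c) := IsLocalization.map_units (Localization.AtPrime p) c
    exact (Ideal.unit_mul_mem_iff_mem _ hcu).1 h3

/-- A vector space over an infinite field is not a finite union of proper subspaces. -/
theorem exists_linear_form_notMem (s : Set (Ideal PolyRing)) (hs : s.Finite)
    (h : ∀ p ∈ s, ¬ idealOfVars (Fin 3) ℂ ≤ p) :
    ∃ l : PolyRing, l.IsHomogeneous 1 ∧ ∀ p ∈ s, l ∉ p := by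
  have := hs.to_subtype
  set φ : (Fin 3 → ℂ) →ₗ[ℂ] PolyRing := Fintype.linearCombination ℂ (X : Fin 3 → PolyRing)
  by_contra! hc
  obtain ⟨p, hp⟩ := Subspace.exists_eq_top_of_iUnion_eq_univ
    (p := fun p : s ↦ (p.1.restrictScalars ℂ).comap φ) (Set.eq_univ_of_forall fun c ↦ by
      obtain ⟨p, hps, hp⟩ := hc (φ c) (by
        rw [← mem_homogeneousSubmodule, Fintype.linearCombination_apply]
        exact Submodule.sum_mem _ fun i _ ↦ Submodule.smul_mem _ _ (isHomogeneous_X ℂ i))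
      exact Set.mem_iUnion.2 ⟨⟨p, hps⟩, hp⟩)
  refine h p p.2 (Ideal.span_le.2 ?_)
  rintro _ ⟨i, rfl⟩
  have : Pi.single i 1 ∈ (p.1.restrictScalars ℂ).comap φ := hp ▸ Submodule.mem_top
  simpa [φ] using this

/-- A general homogeneous combination of two vectors lies in none of finitely many primes. -/
theorem exists_homogeneous_combination_notMem {ι : Type*} (s : Set (Ideal PolyRing)) (hs : s.Finite)
    (hprime : ∀ p ∈ s, p.IsPrime) (h : ∀ p ∈ s, ¬ idealOfVars (Fin 3) ℂ ≤ p)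
    {v w : ι → PolyRing} (hvw : ∀ p ∈ s, (∃ i, v i ∉ p) ∨ ∃ i, w i ∉ p) (k : ℕ) :
    ∃ g : PolyRing, g.IsHomogeneous k ∧ ∀ p ∈ s, ∃ i, w i + g * v i ∉ p := by
  obtain ⟨l, hl, hls⟩ := exists_linear_form_notMem s hs h
  -- Subtracting the conditions for two bad constants puts `v` in `p`, and then `w` as well; so each
  -- prime excludes at most one `c`.
  have hbad : ∀ p ∈ s, {c : ℂ | ∀ i, w i + C c * l ^ k * v i ∈ p}.Subsingleton := by
    intro p hp c hc c' hc'
    have := hprime p hp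
    by_contra hne
    have hv : ∀ i, v i ∈ p := fun i ↦ by
      have h1 : (C (c - c') * l ^ k) * v i ∈ p := by
        have := p.sub_mem (hc i) (hc' i)
        convert this using 1
        rw [C_sub]; ring
      refine ((this.mem_or_mem h1).resolve_left fun h2 ↦ ?_)
      rcases this.mem_or_mem h2 with h3 | h3
      · exact this.ne_top (Ideal.eq_top_of_isUnit_mem _ h3
          ((isUnit_iff_ne_zero.2 (sub_ne_zero.2 hne)).map C))
      · exact hls p hp (this.mem_of_pow_mem _ h3)
    have hw : ∀ i, w i ∈ p := fun i ↦ by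
      have := p.sub_mem (hc i) (p.mul_mem_left (C c * l ^ k) (hv i))
      rwa [add_sub_cancel_right] at this
    rcases hvw p hp with ⟨i, hi⟩ | ⟨i, hi⟩
    · exact hi (hv i)
    · exact hi (hw i)
  obtain ⟨c, hc⟩ := (hs.biUnion fun p hp ↦ (hbad p hp).finite).exists_notMem
  refine ⟨C c * l ^ k, ?_, fun p hp ↦ ?_⟩
  · simpa using (isHomogeneous_C (Fin 3) c).mul (hl.pow k)
  · by_contra! hc'
    exact hc (Set.mem_biUnion hp hc')

/-- An irredundant generating family has no nonzero syzygy with constant entries. -/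
theorem eq_zero_of_isHomogeneous_zero {σ K : Type*} [Field K] {f v : Fin 3 → MvPolynomial σ K}
    (hirr : ∀ i, f i ∉ Ideal.span (f '' {j | j ≠ i})) (hv : ∀ i, (v i).IsHomogeneous 0)
    (hvf : ∑ i, v i * f i = 0) : v = 0 := by
  by_contra hne
  obtain ⟨i, hi⟩ := Function.ne_iff.1 hne
  obtain ⟨c, hc⟩ : ∃ c, v i = C c := ⟨_, (totalDegree_eq_zero_iff_eq_C.1
    ((totalDegree_zero_iff_isHomogeneous _).2 (hv i)))⟩
  have hc0 : c ≠ 0 := by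
    rintro rfl
    exact hi (by simpa using hc)
  refine hirr i ?_
  rw [← Finset.add_sum_erase _ _ (Finset.mem_univ i)] at hvf
  have h1 : C c * f i ∈ Ideal.span (f '' {j | j ≠ i}) := by
    rw [← hc, eq_neg_of_add_eq_zero_left hvf]
    refine neg_mem (Ideal.sum_mem _ fun j hj ↦ Ideal.mul_mem_left _ _ (Ideal.subset_span ?_))
    exact ⟨j, Finset.ne_of_mem_erase hj, rfl⟩
  exact (Ideal.unit_mul_mem_iff_mem _ ((isUnit_iff_ne_zero.2 hc0).map C)).1 h1

/-- A Cohen–Macaulay ideal of height two which is locally a complete intersection and minimally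
generated by three forms of the same degree has a regular syzygy. -/
theorem exists_isRegularTriple_syzygy {f : Fin 3 → PolyRing} {d : ℕ}
    (hf : ∀ i, (f i).IsHomogeneous d) (hirr : ∀ i, f i ∉ Ideal.span (f '' {j | j ≠ i}))
    (hI : (Ideal.span (Set.range f)).height = 2)
    (hlci : IsLocallyCompleteIntersection (Ideal.span (Set.range f)))
    (hCM : IsArithmeticallyCM (Ideal.span (Set.range f))) :
    ∃ A : Fin 3 → PolyRing, A 0 * f 0 + A 1 * f 1 + A 2 * f 2 = 0 ∧
      IsRegularTriple (A 0) (A 1) (A 2) ∧ Ideal.span {A 0, A 1, A 2} ≠ ⊤ := by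
  set I := Ideal.span (Set.range f) with hIdef
  have hf' : ∀ i, ∃ n, (f i).IsHomogeneous n := fun i ↦ ⟨d, hf i⟩
  have hne : f ≠ 0 := by
    rintro rfl
    exact hirr 0 (Ideal.zero_mem _)
  have hcop := exists_not_dvd_of_two_le_height hI.ge
  obtain ⟨v, w, m, n, hmn, hv, hw, hex, hinj⟩ := exists_homogeneous_syzygy_basis hf hne
    fun s hs ↦ hCM.mem_of_forall_mul_mem hf' hI hs
  have hL : ∀ a, Fintype.linearCombination PolyRing ![v, w] a = a 0 • v + a 1 • w := fun a ↦ by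
    simp [Fintype.linearCombination_apply]
  have hF : ∀ p, Fintype.linearCombination PolyRing f p = p 0 * f 0 + p 1 * f 1 + p 2 * f 2 :=
    fun p ↦ by simp [Fintype.linearCombination_apply, Fin.sum_univ_three]
  obtain ⟨g, hg, hcross⟩ := exists_isUnit_cross_eq_smul hcop hne hex hinj
  have hv0 : v 0 * f 0 + v 1 * f 1 + v 2 * f 2 = 0 := by
    rw [← hF]; exact (hex v).2 ⟨![1, 0], by simp [hL]⟩
  have hw0 : w 0 * f 0 + w 1 * f 1 + w 2 * f 2 = 0 := by
    rw [← hF]; exact (hex w).2 ⟨![0, 1], by simp [hL]⟩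
  -- Positive degree is what makes the entries of `A` vanish at the origin.
  have hm : m ≠ 0 := by
    rintro rfl
    have := eq_zero_of_isHomogeneous_zero hirr hv (by rw [Fin.sum_univ_three, hv0])
    rw [this] at hcross
    have h0 : g • f = 0 := by rw [← hcross]; simp
    exact hne ((hg.smul_eq_zero).1 h0)
  have hmax := idealOfVars_isMaximal (Fin 3) ℂ
  have hprime : ∀ p ∈ I.minimalPrimes, p.IsPrime := fun p hp ↦ hp.1.1
  have hnle : ∀ p ∈ I.minimalPrimes, ¬ idealOfVars (Fin 3) ℂ ≤ p := fun p hp hle ↦ by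
    have := hmax.eq_of_le (hprime p hp).ne_top hle
    exact idealOfVars_notMem_minimalPrimes hf' hI (this ▸ hp)
  obtain ⟨h, hh, hhp⟩ := exists_homogeneous_combination_notMem I.minimalPrimes
    (Ideal.finite_minimalPrimes_of_isNoetherianRing _ I) hprime hnle (v := v) (w := w) (by
      intro p hp
      have := hprime p hp
      obtain ⟨a, b, hab⟩ := hlci p hp
      obtain ⟨t, ht, j, hj⟩ := exists_syzygy_notMem p hab
      obtain ⟨c, hc⟩ := (hex t).1 (by rw [hF, ht])
      by_contra! hc'
      refine hj ?_
      rw [← hc, hL]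
      exact p.add_mem (p.mul_mem_left _ (hc'.1 j)) (p.mul_mem_left _ (hc'.2 j))) (n - m)
  set A : Fin 3 → PolyRing := fun i ↦ w i + h * v i with hA
  have hAhom : ∀ i, (A i).IsHomogeneous n := fun i ↦ by
    refine (hw i).add ?_
    have := hh.mul (hv i)
    rwa [Nat.sub_add_cancel hmn] at this
  have hAm : ∀ i, A i ∈ idealOfVars (Fin 3) ℂ := fun i ↦ by
    rw [mem_idealOfVars_iff]
    refine (hAhom i).coeff_eq_zero ?_
    rw [map_zero]
    omega
  have hheight : ∀ Q : Ideal PolyRing, Q.IsPrime → A 0 ∈ Q → A 1 ∈ Q → A 2 ∈ Q →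
      3 ≤ Q.height := by
    intro Q hQ h0 h1 h2
    have hAQ : ∀ i, A i ∈ Q := fun i ↦ by fin_cases i <;> assumption
    -- A column operation leaves the minors unchanged, so a prime containing `A` contains `I`.
    have hcrossA : v ⨯₃ A = g • f := by
      have : A = w + h • v := rfl
      rw [this, ← hcross]
      simp
    have hIQ : I ≤ Q := by
      rw [hIdef, Ideal.span_le]
      rintro _ ⟨i, rfl⟩
      refine (Ideal.unit_mul_mem_iff_mem _ hg).1 ?_
      have : g * f i = (v ⨯₃ A) i := by rw [hcrossA]; rfl
      rw [this, cross_apply]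
      fin_cases i <;>
        exact Q.sub_mem (Q.mul_mem_left _ (hAQ _)) (Q.mul_mem_left _ (hAQ _))
    obtain ⟨p, hp, hpQ⟩ := Ideal.exists_minimalPrimes_le hIQ
    have := hprime p hp
    have hlt : p < Q := by
      refine lt_of_le_of_ne hpQ ?_
      rintro rfl
      obtain ⟨i, hi⟩ := hhp p hp
      exact hi (hAQ i)
    have h3 := Ideal.height_add_one_le_of_lt_of_isPrime hlt
    have h4 : 2 ≤ p.height := hI ▸ Ideal.height_mono hp.1.2
    refine le_trans ?_ h3
    exact (by norm_num : (3 : ℕ∞) = 2 + 1).le.trans (add_le_add_left h4 1)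
  refine ⟨A, ?_, isRegularTriple_of_three_le_height (hAhom 0) (hAm 0) (hAm 1) (hAm 2) hheight, ?_⟩
  · simp only [hA]
    linear_combination hw0 + h * hv0
  · refine ne_top_of_le_ne_top hmax.ne_top (Ideal.span_le.2 ?_)
    rintro _ (rfl | rfl | rfl) <;> exact hAm _

theorem theorem2p1 (I : Ideal PolyRing) (hheight : I.height = 2)
    (hlci : IsLocallyCompleteIntersection I)
    (hgen : IsMinimallyGeneratedByThreeOfSameDegree I) :
    IsArithmeticallyCM I ↔ ∃ A B C : PolyRing, IsRegularSyzygy I A B C := by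
  constructor
  · intro hCM
    obtain ⟨d, f, hf, hd⟩ := hgen
    obtain rfl := hf.span_eq
    obtain ⟨A, hAf, hreg, hne⟩ := exists_isRegularTriple_syzygy hd hf.irredundant hheight hlci hCM
    exact ⟨A 0, A 1, A 2, ⟨f, hf, hAf⟩, isRegular_triple_iff.2 ⟨hreg, hne⟩⟩
  · rintro ⟨A, B, C, ⟨f, hf, hABC⟩, hreg⟩
    obtain rfl := hf.span_eq
    exact isArithmeticallyCM_of_isRegularTriple (A := ![A, B, C]) hheight
      (isRegular_triple_iff.1 hreg).1 hABC
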